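/- Let $M$ be a closed hyperbolic $3$-manifold, i.e. a compact connected Hausdorff space without boundary that carries a hyperbolic structure (an atlas of charts in $\mathbb H^3$ whose changes of charts are local isometries). For $g\ge 0$ let $S_g$ denote the closed orientable surface of genus $g$. For a homeomorphism $\phi:S_g\to S_g$ let $M_\phi=S_g\times[0,1]/(x,0)\sim(\phi(x),1)$ be its mapping torus. Let $b_1(M)=\dim_{\mathbb R}H_1(M;\mathbb R)$ be the first Betti number of $M$, and define the fiber genus of $M$ by $$fg(M)=\inf\{g\ge 0:\ \text{there are a homeomorphism } \phi:S_g\to S_g \text{ and a covering map } M_\phi\to M\}$$ (with $\inf\emptyset=\infty$). Then $$fg(M)\ \ge\ \frac{b_1(M)-1}{2}.$$ -/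

import Mathlib

open CategoryTheory AlgebraicTopology
open scoped unitInterval ENNReal

universe u

/-! ### Closed hyperbolic 3-manifolds -/

/-- Hyperbolic 3-space, as the upper half-space `{(x, y, t) ∈ ℝ³ : t > 0}`, with the topology
induced from `ℝ³`. -/
abbrev HyperbolicSpace3 : Type := {p : EuclideanSpace ℝ (Fin 3) // 0 < p 2}

/-- The hyperbolic distance (curvature `-1`) on the upper half-space, where `‖·‖` is the Euclidean
norm and `t(p)` is the height of `p`:
`d(p, q) = 2 arsinh (‖p - q‖ / (2 √(t(p) t(q))))`. -/
noncomputable def hyperbolicDist (p q : HyperbolicSpace3) : ℝ :=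
  2 * Real.arsinh (‖p.1 - q.1‖ / (2 * √(p.1 2 * q.1 2)))

/-- `M` carries a hyperbolic structure modelled on hyperbolic 3-space: there is an atlas of charts
with values in open subsets of hyperbolic 3-space whose changes of charts are local isometries of
the hyperbolic distance. -/
def HasHyperbolicStructure3 (M : Type u) [TopologicalSpace M] : Prop :=
  ∃ A : Set (OpenPartialHomeomorph M HyperbolicSpace3),
    (∀ x : M, ∃ e ∈ A, x ∈ e.source) ∧
    ∀ e ∈ A, ∀ e' ∈ A, ∀ x ∈ e.source ∩ e'.source,
      ∃ U : Set M, IsOpen U ∧ x ∈ U ∧ U ⊆ e.source ∩ e'.source ∧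
        ∀ y ∈ U, ∀ z ∈ U, hyperbolicDist (e y) (e z) = hyperbolicDist (e' y) (e' z)

/-- A closed hyperbolic 3-manifold: a compact connected Hausdorff space, without boundary, with a
hyperbolic structure (which is complete because the space is compact). -/
structure IsClosedHyperbolicManifold3 (M : Type u) [TopologicalSpace M] : Prop where
  t2 : T2Space M
  compact : CompactSpace M
  connected : ConnectedSpace M
  hyperbolic : HasHyperbolicStructure3 M

/-! ### Betti numbers -/

/-- The `n`-th singular homology of `M` with real coefficients. -/
noncomputable abbrev realSingularHomology (n : ℕ) (M : Type u) [TopologicalSpace M] :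
    ModuleCat.{u} ℝ :=
  ((singularHomologyFunctor (ModuleCat.{u} ℝ) n).obj (ModuleCat.of ℝ (ULift.{u} ℝ))).obj
    (TopCat.of M)

/-- The `n`-th Betti number of `M`, the dimension of `Hₙ(M; ℝ)`. -/
noncomputable def bettiNumber (n : ℕ) (M : Type u) [TopologicalSpace M] : ℕ :=
  Module.finrank ℝ (realSingularHomology n M)

/-! ### The closed orientable surface of genus `g` -/

/-- The closed unit disc. -/
abbrev ClosedDisc : Type := Metric.closedBall (0 : ℂ) 1

/-- The boundary point `exp (2πi t)` of the closed unit disc. -/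
noncomputable def discBoundary (t : ℝ) : ClosedDisc :=
  ⟨Circle.exp (2 * Real.pi * t), by rw [mem_closedBall_zero_iff, Circle.norm_coe]⟩

/-- The side pairing of the `4g`-gon with boundary word `∏ᵢ aᵢ bᵢ aᵢ⁻¹ bᵢ⁻¹`. The `k`-th side is
the arc of the points `discBoundary t` with `k / (4g) ≤ t ≤ (k + 1) / (4g)`.
For `g = 0` the whole boundary circle is collapsed to a point. -/
inductive SurfaceRel (g : ℕ) : ClosedDisc → ClosedDisc → Prop
  | sideA (i : ℕ) (hi : i < g) (s : ℝ) (hs : s ∈ Set.Icc (0 : ℝ) 1) :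
      SurfaceRel g (discBoundary ((4 * i + s) / (4 * g)))
        (discBoundary ((4 * i + 3 - s) / (4 * g)))
  | sideB (i : ℕ) (hi : i < g) (s : ℝ) (hs : s ∈ Set.Icc (0 : ℝ) 1) :
      SurfaceRel g (discBoundary ((4 * i + 1 + s) / (4 * g)))
        (discBoundary ((4 * i + 4 - s) / (4 * g)))
  | sphere (hg : g = 0) (s t : ℝ) : SurfaceRel g (discBoundary s) (discBoundary t)

/-- The closed orientable surface `S_g` of genus `g`: the closed disc, seen as a `4g`-gon, modulo
the equivalence relation generated by the side pairing. For `g = 0` it is the sphere. -/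
def ClosedSurface (g : ℕ) : Type := Quot (SurfaceRel g)

instance (g : ℕ) : TopologicalSpace (ClosedSurface g) :=
  inferInstanceAs (TopologicalSpace (Quot (SurfaceRel g)))

/-! ### Mapping tori and the fiber genus -/

/-- The gluing `(x, 0) ∼ (φ x, 1)` on `S × [0, 1]`. -/
inductive MappingTorusRel {S : Type*} [TopologicalSpace S] (φ : S ≃ₜ S) : S × I → S × I → Prop
  | glue (x : S) : MappingTorusRel φ (x, 0) (φ x, 1)

/-- The mapping torus `S × [0, 1] / (x, 0) ∼ (φ x, 1)` of a homeomorphism `φ : S → S`, which fibers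
over the circle `[0, 1] / 0 ∼ 1` with fiber `S`. -/
def MappingTorus {S : Type*} [TopologicalSpace S] (φ : S ≃ₜ S) : Type _ :=
  Quot (MappingTorusRel φ)

instance {S : Type*} [TopologicalSpace S] (φ : S ≃ₜ S) : TopologicalSpace (MappingTorus φ) :=
  inferInstanceAs (TopologicalSpace (Quot (MappingTorusRel φ)))

/-- `M` has a fibered covering with a fiber of genus `g`: some mapping torus of a homeomorphism of
`S_g` covers `M`. (The mapping torus is compact, so the covering has finite degree.) -/
def HasFiberedCovering (M : Type u) [TopologicalSpace M] (g : ℕ) : Prop :=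
  ∃ (φ : ClosedSurface g ≃ₜ ClosedSurface g) (p : MappingTorus φ → M), IsCoveringMap p

/-- The fiber genus of `M`, the infimum of all `g` such that `M` has a fibered covering with a
fiber of genus `g` (and `∞` if there is none). -/
noncomputable def fiberGenus (M : Type u) [TopologicalSpace M] : ℕ∞ :=
  ⨅ (g : ℕ) (_ : HasFiberedCovering M g), (g : ℕ∞)

/-!
Let `p : M_φ → M` be a covering by the mapping torus of a homeomorphism `φ` of `S_g`. The theorem
says that `H₁(M; ℝ)` has dimension at most `2 g + 1`, the number of standard generators of
`π₁(M_φ)`. The proof avoids the fundamental group and the homology of `M_φ`, and works with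
1-cocycles on `M`.

Since `ℝ` is a field, `H₁(M; ℝ)` is a direct summand of the 1-chains modulo boundaries, and a
retraction assigns to every path of `M` an element of `H₁(M; ℝ)`. This is a cocycle `c`
(`exists_universal_pathCocycle`), and if `c` is the coboundary of a function modulo a subspace `W`,
then `W` contains the class of every cycle, that is, `W = ⊤`.

Pulled back to `disc × [0, 1]`, which is convex, `c` is the coboundary of a function `f`
(`IsPathCocycle.exists_isPrimitiveAlong_of_convex_prod`). The mapping torus is a quotient of
`disc × [0, 1]`, so one asks when `f` descends to it. As `M` is locally contractible, `c` is locally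
exact, and the germs of its primitives form a covering space of `M`; therefore two primitives with
the same underlying map to `M` differ by a constant on connected spaces. Hence `f` is
compatible with a pair of identified sides of the polygon, or with the gluing by `φ`, as soon as it is compatible with one
pair of identified points (`IsLocalPrimitive.apply_eq_apply`). This gives `2 g + 1` differences of
values of `f`. Modulo their span `W` the function descends to the mapping torus
(`IsPrimitiveAlong.exists_descent`). What descends along quotient maps is the property of being a
local primitive, which is the continuity of a section of the covering of primitives and does not
refer to paths, since these need not lift through a quotient map.

Finally `p` has finite fibers, and averaging a primitive over them makes `c` exact modulo `W` on `M`
itself (`IsCoveringMap.exists_primitive`). So `W = ⊤`, and `H₁(M; ℝ)` is spanned by `2 g + 1`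
elements. The hyperbolic structure enters only through the existence of local charts.
-/

open Topology Set Filter

/-! ### Path cocycles and their primitives -/

section PathCocycle

variable {M V : Type*} [TopologicalSpace M] [AddCommGroup V]

/-- A `V`-valued 1-cocycle on paths of `M`. The relation is that of a 2-simplex, written for the
triangle with vertices `(0, 0)`, `(1, 0)`, `(1, 1)` of a square `K : I × I → M`; the other triangle
of the square is obtained by exchanging the coordinates. -/
def IsPathCocycle (c : C(I, M) → V) : Prop :=
  ∀ K : C(I × I, M),
    c (K.comp ((ContinuousMap.id I).prodMk (.const I 0))) +
      c (K.comp ((ContinuousMap.const I 1).prodMk (.id I))) =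
    c (K.comp ((ContinuousMap.id I).prodMk (.id I)))

/-- `h` is a primitive of `c` on `U`: the values of `c` on paths in `U` are the increments
of `h`. -/
def IsPrimitiveOn (c : C(I, M) → V) (h : M → V) (U : Set M) : Prop :=
  ∀ γ : C(I, M), (∀ t, γ t ∈ U) → c γ = h (γ 1) - h (γ 0)

/-- `c` is locally exact: every point of `M` has an open neighbourhood on which `c` has a
primitive. -/
def IsLocallyExact (c : C(I, M) → V) : Prop :=
  ∀ m : M, ∃ U : Set M, IsOpen U ∧ m ∈ U ∧ ∃ h : M → V, IsPrimitiveOn c h U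

/-- `f` is a primitive of the pullback of `c` along `q : X → M`. -/
def IsPrimitiveAlong {X : Type*} [TopologicalSpace X] (c : C(I, M) → V) (q : C(X, M))
    (f : X → V) : Prop :=
  ∀ γ : C(I, X), c (q.comp γ) = f (γ 1) - f (γ 0)

/-- `f : X → V` is a local primitive of `c` along `q : X → M`: near every point, `f` differs from
the pullback of any primitive of `c` on an open subset of `M` by a constant. For a locally exact
`c` on a locally path-connected `M` this says that `x ↦ (q x, f x)` is a continuous section of the covering space of germs of
primitives of `c`. Unlike `IsPrimitiveAlong`, this does not refer to the paths of `X`, which makes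
it descend along quotient maps. -/
def IsLocalPrimitive {X : Type*} [TopologicalSpace X] (c : C(I, M) → V) (q : X → M)
    (f : X → V) : Prop :=
  ∀ (x : X) (U : Set M), IsOpen U → q x ∈ U → ∀ h : M → V, IsPrimitiveOn c h U →
    ∀ᶠ x' in 𝓝 x, f x' - h (q x') = f x - h (q x)

variable {c : C(I, M) → V}

theorem IsPathCocycle.const_eq_zero (hc : IsPathCocycle c) (m : M) : c (.const I m) = 0 := by
  have h := hc (.const (I × I) m)
  simp only [ContinuousMap.const_comp] at h
  simpa using h

theorem IsPathCocycle.square (hc : IsPathCocycle c) (K : C(I × I, M)) :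
    c (K.comp ((ContinuousMap.id I).prodMk (.const I 0))) +
      c (K.comp ((ContinuousMap.const I 1).prodMk (.id I))) =
    c (K.comp ((ContinuousMap.const I 0).prodMk (.id I))) +
      c (K.comp ((ContinuousMap.id I).prodMk (.const I 1))) := by
  rw [hc K]
  exact (hc (K.comp ContinuousMap.prodSwap)).symm

theorem IsPathCocycle.map {V' : Type*} [AddCommGroup V'] (hc : IsPathCocycle c) (L : V →+ V') :
    IsPathCocycle (L ∘ c) := by
  intro K
  simp only [Function.comp_apply, ← hc K, map_add]

theorem IsLocallyExact.map {V' : Type*} [AddCommGroup V'] (hc : IsLocallyExact c) (L : V →+ V') :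
    IsLocallyExact (L ∘ c) := by
  intro m
  obtain ⟨U, hU, hm, h, hh⟩ := hc m
  exact ⟨U, hU, hm, L ∘ h, fun γ hγ => by simp [hh γ hγ]⟩

theorem IsPrimitiveAlong.map {X V' : Type*} [TopologicalSpace X] [AddCommGroup V']
    {q : C(X, M)} {f : X → V} (hf : IsPrimitiveAlong c q f) (L : V →+ V') :
    IsPrimitiveAlong (L ∘ c) q (L ∘ f) := fun γ => by simp [hf γ]

/-- The Poincaré lemma: a path cocycle becomes exact on a convex set. The primitive at `y` is the
value on the segment from a base point to `y`. -/
theorem IsPathCocycle.exists_isPrimitiveAlong_of_convex (hc : IsPathCocycle c) {E : Type*}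
    [AddCommGroup E] [Module ℝ E] [TopologicalSpace E] [IsTopologicalAddGroup E]
    [ContinuousSMul ℝ E] {C : Set E} (hC : Convex ℝ C) (hne : C.Nonempty) (q : C(C, M)) :
    ∃ f : C → V, IsPrimitiveAlong c q f := by
  obtain ⟨x₀, hx₀⟩ := hne
  -- Apply the square relation to the cone of `γ` with apex `x₀`, whose left side is constant.
  let cone (γ : C(I, C)) : C(I × I, C) :=
    ⟨fun p => ⟨(1 - (p.1 : ℝ)) • x₀ + (p.1 : ℝ) • (γ p.2 : E),
      hC hx₀ (γ p.2).2 (sub_nonneg.2 p.1.2.2) p.1.2.1 (by ring)⟩, by fun_prop⟩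
  let seg (y : C) : C(I, C) := (cone (.const I y)).comp ((ContinuousMap.id I).prodMk (.const I 0))
  refine ⟨fun y => c (q.comp (seg y)), fun γ => ?_⟩
  have h := hc.square (q.comp (cone γ))
  have h0 : (q.comp (cone γ)).comp ((ContinuousMap.const I 0).prodMk (.id I)) =
      .const I (q ⟨x₀, hx₀⟩) := by
    ext t
    simp [cone]
  have h1 : (q.comp (cone γ)).comp ((ContinuousMap.const I 1).prodMk (.id I)) = q.comp γ := by
    ext t
    simp [cone]
  rw [h0, h1, hc.const_eq_zero, zero_add] at h
  exact eq_sub_of_add_eq' h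

theorem IsPrimitiveAlong.isLocalPrimitive {X : Type*} [TopologicalSpace X]
    [LocallyPathConnectedSpace X] {q : C(X, M)} {f : X → V} (hf : IsPrimitiveAlong c q f) :
    IsLocalPrimitive c q f := by
  intro x U hU hx h hh
  obtain ⟨W, ⟨hW, hWc⟩, hWU⟩ := (path_connected_basis x).mem_iff.1
    ((hU.preimage q.continuous).mem_nhds hx)
  filter_upwards [hW] with x' hx'
  obtain ⟨γ, hγ⟩ := hWc.joinedIn x (mem_of_mem_nhds hW) x' hx'
  have h1 := hf γ.toContinuousMap
  have h2 := hh (q.comp γ.toContinuousMap) fun t => hWU (hγ t)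
  simp only [ContinuousMap.comp_apply, Path.coe_toContinuousMap, Path.source, Path.target]
    at h1 h2
  rw [h1] at h2
  rw [sub_eq_sub_iff_sub_eq_sub, h2]

theorem IsLocalPrimitive.comp {X Y : Type*} [TopologicalSpace X] [TopologicalSpace Y] {q : X → M}
    {f : X → V} (hf : IsLocalPrimitive c q f) {g : Y → X} (hg : Continuous g) :
    IsLocalPrimitive c (q ∘ g) (f ∘ g) := fun y U hU hy h hh =>
  hg.continuousAt.eventually (hf (g y) U hU hy h hh)

theorem IsLocalPrimitive.sub_eq_sub {X : Type*} [TopologicalSpace X] [PreconnectedSpace X]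
    (hc : IsLocallyExact c) {q : X → M} {f f' : X → V} (hf : IsLocalPrimitive c q f)
    (hf' : IsLocalPrimitive c q f') (x y : X) : f x - f' x = f y - f' y := by
  have : IsLocallyConstant fun x => f x - f' x := by
    rw [IsLocallyConstant.iff_eventually_eq]
    intro x
    obtain ⟨U, hU, hx, h, hh⟩ := hc (q x)
    filter_upwards [hf x U hU hx h hh, hf' x U hU hx h hh] with x' h1 h2
    rw [← sub_sub_sub_cancel_right (f x') (f' x') (h (q x')), h1, h2, sub_sub_sub_cancel_right]
  exact this.apply_eq_of_preconnectedSpace x y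

theorem IsLocalPrimitive.of_comp_isQuotientMap {X Y : Type*} [TopologicalSpace X]
    [TopologicalSpace Y] {π : X → Y} (hπ : IsQuotientMap π) {q : Y → M} (hq : Continuous q)
    {f : Y → V} (hf : IsLocalPrimitive c (q ∘ π) (f ∘ π)) : IsLocalPrimitive c q f := by
  intro y U hU hy h hh
  -- The preimage of this set is open because `f ∘ π` is a local primitive.
  have hA : IsOpen {y' | y' ∈ q ⁻¹' U ∧ f y' - h (q y') = f y - h (q y)} := by
    rw [← hπ.isOpen_preimage, isOpen_iff_eventually]
    rintro x ⟨hxU, hx⟩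
    filter_upwards [hf x U hU hxU h hh,
      ((hU.preimage (hq.comp hπ.continuous)).mem_nhds hxU)] with x' h1 h2
    exact ⟨h2, h1.trans hx⟩
  filter_upwards [hA.mem_nhds ⟨hy, rfl⟩] with y' hy'
  exact hy'.2

/-- Local primitives compute the cocycle on all paths, however they cross the neighbourhoods on
which it is known to be exact. -/
theorem IsLocalPrimitive.isPrimitiveAlong {X : Type*} [TopologicalSpace X] (hc : IsPathCocycle c)
    (hl : IsLocallyExact c) {q : C(X, M)} {f : X → V} (hf : IsLocalPrimitive c q f) :
    IsPrimitiveAlong c q f := by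
  intro γ
  -- On the interval, a global primitive exists, and it differs from `f ∘ γ` by a constant.
  obtain ⟨g, hg⟩ := hc.exists_isPrimitiveAlong_of_convex (convex_Icc (0 : ℝ) 1)
    (nonempty_Icc.2 zero_le_one) (q.comp γ)
  have : LocallyPathConnectedSpace (Icc (0 : ℝ) 1) := (convex_Icc 0 1).locallyPathConnectedSpace
  have h := (hf.comp γ.continuous).sub_eq_sub hl hg.isLocalPrimitive 1 0
  have h1 : c (q.comp γ) = g 1 - g 0 := hg (.id _)
  rw [h1, eq_comm, ← sub_eq_sub_iff_sub_eq_sub]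
  exact h

end PathCocycle

/-- Quotient maps are stable under product with a locally compact space. -/
theorem Topology.IsQuotientMap.prodMap_id {X Y Z : Type*} [TopologicalSpace X]
    [TopologicalSpace Y] [TopologicalSpace Z] [LocallyCompactSpace Z] {π : X → Y}
    (hπ : IsQuotientMap π) : IsQuotientMap (Prod.map π (id : Z → Z)) := by
  have hcont : Continuous (Prod.map π (id : Z → Z)) := hπ.continuous.prodMap continuous_id
  refine ⟨isCoinducing_iff.2 fun s => ⟨fun hs => ?_, fun hs => hs.preimage hcont⟩,
    hπ.surjective.prodMap Function.surjective_id⟩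
  -- Openness of a set is continuity of its indicator into the Sierpiński space `Prop`.
  refine isOpen_iff_continuous_mem.2 (hπ.continuous_lift_prod_left ?_)
  exact isOpen_iff_continuous_mem.1 hs

/-! ### Local exactness on manifolds -/

theorem IsPathCocycle.isLocallyExact_of_charts {M V E : Type*} [TopologicalSpace M]
    [AddCommGroup V] [NormedAddCommGroup E] [NormedSpace ℝ E] {c : C(I, M) → V}
    (hc : IsPathCocycle c) (hM : ∀ x : M, ∃ e : OpenPartialHomeomorph M E, x ∈ e.source) :
    IsLocallyExact c := by
  classical
  intro m
  obtain ⟨e, hm⟩ := hM m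
  obtain ⟨r, hr, hball⟩ := Metric.isOpen_iff.1 e.open_target (e m) (e.map_source hm)
  let q : C(Metric.ball (e m) r, M) := ⟨fun y => e.symm y,
    e.continuousOn_symm.comp_continuous continuous_subtype_val fun y => hball y.2⟩
  obtain ⟨f, hf⟩ := hc.exists_isPrimitiveAlong_of_convex (convex_ball (e m) r)
    ⟨_, Metric.mem_ball_self hr⟩ q
  refine ⟨e.source ∩ e ⁻¹' Metric.ball (e m) r, e.isOpen_inter_preimage Metric.isOpen_ball,
    ⟨hm, Metric.mem_ball_self hr⟩,
    fun x => if hx : e x ∈ Metric.ball (e m) r then f ⟨e x, hx⟩ else 0, fun γ hγ => ?_⟩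
  let γ' : C(I, Metric.ball (e m) r) := ⟨fun t => ⟨e (γ t), (hγ t).2⟩,
    (e.continuousOn.comp_continuous γ.continuous fun t => (hγ t).1).subtype_mk _⟩
  have hqγ : q.comp γ' = γ := by
    ext t
    exact e.left_inv (hγ t).1
  have h1 : e (γ 1) ∈ Metric.ball (e m) r := (hγ 1).2
  have h0 : e (γ 0) ∈ Metric.ball (e m) r := (hγ 0).2
  beta_reduce
  rw [dif_pos h1, dif_pos h0]
  exact (congrArg c hqγ).symm.trans (hf γ')

theorem HasHyperbolicStructure3.exists_euclidean_chart {M : Type u} [TopologicalSpace M]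
    (hM : HasHyperbolicStructure3 M) (x : M) :
    ∃ e : OpenPartialHomeomorph M (EuclideanSpace ℝ (Fin 3)), x ∈ e.source := by
  obtain ⟨A, hA, -⟩ := hM
  obtain ⟨e, -, hx⟩ := hA x
  have : Nonempty {p : EuclideanSpace ℝ (Fin 3) | 0 < p 2} := ⟨e x⟩
  have hopen : IsOpen {p : EuclideanSpace ℝ (Fin 3) | 0 < p 2} :=
    isOpen_lt continuous_const (by fun_prop)
  exact ⟨e.trans (hopen.isOpenEmbedding_subtypeVal.toOpenPartialHomeomorph _), by simpa using hx⟩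

/-! ### Finite coverings -/

theorem IsCoveringMap.surjective {E X : Type*} [TopologicalSpace E] [TopologicalSpace X]
    [Nonempty E] [PreconnectedSpace X] {p : E → X} (hp : IsCoveringMap p) :
    Function.Surjective p := by
  -- A covering map may have empty fibers, but the points with an empty fiber form an open set.
  have hcl : IsClopen (range p) := by
    refine ⟨isOpen_compl_iff.1 (isOpen_iff_mem_nhds.2 fun x hx => ?_), hp.isOpenMap.isOpen_range⟩
    have hE : IsEmpty (p ⁻¹' {x}) := ⟨fun y => hx ⟨y, y.2⟩⟩
    obtain ⟨-, U, hxU, hU, -, H, -⟩ := hp x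
    refine mem_of_superset (hU.mem_nhds hxU) ?_
    rintro _ hyU ⟨y, rfl⟩
    exact hE.elim (H ⟨y, hyU⟩).2
  exact range_eq_univ.1 (hcl.eq_univ (range_nonempty p))

theorem IsCoveringMap.finite_fiber {E X : Type*} [TopologicalSpace E] [TopologicalSpace X]
    [CompactSpace E] [T1Space X] {p : E → X} (hp : IsCoveringMap p) (x : X) :
    Finite (p ⁻¹' {x}) := by
  have := (hp x).discreteTopology_fiber
  have : CompactSpace (p ⁻¹' {x}) :=
    isCompact_iff_compactSpace.1 (isClosed_singleton.preimage hp.continuous).isCompact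
  exact finite_of_compact_of_discrete

/-- A cocycle with values in a real vector space is exact if its pullback to a finite covering is:
the averages over the fibers of a primitive upstairs form a primitive downstairs, since lifting a
path pairs the points of the fibers over its two ends. -/
theorem IsCoveringMap.exists_primitive {E X V : Type*} [TopologicalSpace E] [TopologicalSpace X]
    [AddCommGroup V] [Module ℝ V] {p : E → X} (hp : IsCoveringMap p)
    (hs : Function.Surjective p) (hfin : ∀ x, Finite (p ⁻¹' {x})) {c : C(I, X) → V} {f : E → V}
    (hf : IsPrimitiveAlong c ⟨p, hp.continuous⟩ f) :
    ∃ F : X → V, ∀ γ : C(I, X), c γ = F (γ 1) - F (γ 0) := by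
  have (x : X) : Fintype (p ⁻¹' {x}) := Fintype.ofFinite _
  refine ⟨fun x => (Fintype.card (p ⁻¹' {x}) : ℝ)⁻¹ • ∑ y : p ⁻¹' {x}, f y, fun γ => ?_⟩
  let δ : Path (γ 0) (γ 1) := ⟨γ, rfl, rfl⟩
  let e : p ⁻¹' {γ 0} ≃ p ⁻¹' {γ 1} :=
    Equiv.ofBijective _ (hp.monodromy_bijective (Path.Homotopic.Quotient.mk δ))
  have he (y : p ⁻¹' {γ 0}) : f (e y) = f y + c γ := by
    have h := hf (hp.liftPath γ y y.2.symm)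
    have h' : ContinuousMap.comp ⟨p, hp.continuous⟩ (hp.liftPath γ y y.2.symm) = γ :=
      ContinuousMap.ext fun t => congrFun (hp.liftPath_lifts γ y y.2.symm) t
    rw [h', hp.liftPath_zero] at h
    rw [h, add_sub_cancel]
    rfl
  have hcard : (Fintype.card (p ⁻¹' {γ 0}) : ℝ) ≠ 0 := by
    obtain ⟨y, hy⟩ := hs (γ 0)
    have : Nonempty (p ⁻¹' {γ 0}) := ⟨⟨y, hy⟩⟩
    exact_mod_cast Fintype.card_ne_zero
  beta_reduce
  rw [← e.sum_comp, ← Fintype.card_congr e, ← smul_sub, ← Finset.sum_sub_distrib]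
  simp only [he, add_sub_cancel_left, Finset.sum_const, Finset.card_univ]
  rw [← Nat.cast_smul_eq_nsmul ℝ, smul_smul, inv_mul_cancel₀ hcard, one_smul]

/-! ### The universal cocycle with values in homology -/

section Homology

open Simplicial

/-- The singular 1-simplex given by a path. -/
noncomputable def pathSimplex {M : Type u} [TopologicalSpace M] (γ : C(I, M)) :
    TopCat.toSSet.obj (TopCat.of M) _⦋1⦌ :=
  ((TopCat.of M).toSSetObjEquiv (.op ⦋1⦌)).symm
    (γ.comp (stdSimplexHomeomorphUnitInterval : C(stdSimplex ℝ (Fin 2), I)))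

/-- The triangle of the unit square with vertices `(0, 0)`, `(1, 0)`, `(1, 1)`, in this order. -/
noncomputable def squareTriangle : C(stdSimplex ℝ (Fin 3), I × I) where
  toFun t := (⟨t 1 + t 2, add_nonneg (t.2.1 1) (t.2.1 2), by
      have := t.2.2; rw [Fin.sum_univ_three] at this; have := t.2.1 0
      change t.1 1 + t.1 2 ≤ 1
      linarith⟩,
    ⟨t 2, t.2.1 2, (mem_Icc_of_mem_stdSimplex t.2 2).2⟩)
  continuous_toFun := by
    have (i : Fin 3) : Continuous fun t : stdSimplex ℝ (Fin 3) => t i :=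
      (continuous_apply i).comp continuous_subtype_val
    exact ((this 1).add (this 2)).subtype_mk _ |>.prodMk ((this 2).subtype_mk _)

theorem exists_pathSimplex_eq {M : Type u} [TopologicalSpace M]
    (s : TopCat.toSSet.obj (TopCat.of M) _⦋1⦌) : ∃ γ : C(I, M), pathSimplex γ = s := by
  refine ⟨((TopCat.of M).toSSetObjEquiv (.op ⦋1⦌) s).comp
    (stdSimplexHomeomorphUnitInterval.symm : C(I, stdSimplex ℝ (Fin 2))), ?_⟩
  rw [pathSimplex, Equiv.symm_apply_eq]
  ext z
  simp

theorem δ_zero_pathSimplex {M : Type u} [TopologicalSpace M] (γ : C(I, M)) :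
    (TopCat.toSSet.obj (TopCat.of M)).δ 0 (pathSimplex γ) =
      TopCat.toSSetObj₀Equiv.symm (γ 1) := by
  have h (z : stdSimplex ℝ (Fin 1)) : stdSimplexHomeomorphUnitInterval
      (stdSimplex.map (Fin.succAbove (0 : Fin 2)) z) = 1 := by
    rw [Subsingleton.elim z (stdSimplex.vertex 0), stdSimplex.map_vertex]
    rfl
  exact ((TopCat.of M).toSSetObjEquiv _).injective (ContinuousMap.ext fun z => congrArg γ (h z))

theorem δ_one_pathSimplex {M : Type u} [TopologicalSpace M] (γ : C(I, M)) :
    (TopCat.toSSet.obj (TopCat.of M)).δ 1 (pathSimplex γ) =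
      TopCat.toSSetObj₀Equiv.symm (γ 0) := by
  have h (z : stdSimplex ℝ (Fin 1)) : stdSimplexHomeomorphUnitInterval
      (stdSimplex.map (Fin.succAbove (1 : Fin 2)) z) = 0 := by
    rw [Subsingleton.elim z (stdSimplex.vertex 0), stdSimplex.map_vertex]
    rfl
  exact ((TopCat.of M).toSSetObjEquiv _).injective (ContinuousMap.ext fun z => congrArg γ (h z))

theorem squareTriangle_map_succAbove (z : stdSimplex ℝ (Fin 2)) :
    squareTriangle (stdSimplex.map (Fin.succAbove 0) z) =
        (1, stdSimplexHomeomorphUnitInterval z) ∧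
      squareTriangle (stdSimplex.map (Fin.succAbove 1) z) =
        (stdSimplexHomeomorphUnitInterval z, stdSimplexHomeomorphUnitInterval z) ∧
      squareTriangle (stdSimplex.map (Fin.succAbove 2) z) =
        (stdSimplexHomeomorphUnitInterval z, 0) := by
  have hz : z 0 + z 1 = 1 := (Fin.sum_univ_two _).symm.trans z.2.2
  have hz1 : (stdSimplexHomeomorphUnitInterval z : ℝ) = z 1 := rfl
  refine ⟨?_, ?_, ?_⟩ <;> refine Prod.ext (Subtype.ext ?_) (Subtype.ext ?_) <;>
    simp [squareTriangle, FunOnFinite.linearMap_apply_apply, Finset.sum_filter,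
      Fin.sum_univ_two, Fin.succAbove, Fin.lt_def, hz, hz1]

theorem δ_squareTriangle {M : Type u} [TopologicalSpace M] (K : C(I × I, M)) :
    let T := ((TopCat.of M).toSSetObjEquiv (.op ⦋2⦌)).symm (K.comp squareTriangle)
    let S := TopCat.toSSet.obj (TopCat.of M)
    S.δ 0 T = pathSimplex (K.comp ((ContinuousMap.const I 1).prodMk (.id I))) ∧
    S.δ 1 T = pathSimplex (K.comp ((ContinuousMap.id I).prodMk (.id I))) ∧
    S.δ 2 T = pathSimplex (K.comp ((ContinuousMap.id I).prodMk (.const I 0))) :=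
  ⟨((TopCat.of M).toSSetObjEquiv _).injective (ContinuousMap.ext fun z =>
      congrArg K (squareTriangle_map_succAbove z).1),
    ((TopCat.of M).toSSetObjEquiv _).injective (ContinuousMap.ext fun z =>
      congrArg K (squareTriangle_map_succAbove z).2.1),
    ((TopCat.of M).toSSetObjEquiv _).injective (ContinuousMap.ext fun z =>
      congrArg K (squareTriangle_map_succAbove z).2.2)⟩

/-- There is a path cocycle with values in `H₁(M; ℝ)` through which all classes are seen: if it
becomes exact modulo a subspace, then this subspace is everything. -/
theorem exists_universal_pathCocycle (M : Type u) [TopologicalSpace M] :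
    ∃ c : C(I, M) → realSingularHomology 1 M, IsPathCocycle c ∧
      ∀ W : Submodule ℝ (realSingularHomology 1 M),
        (∃ F : M → realSingularHomology 1 M ⧸ W, ∀ γ : C(I, M),
          W.mkQ (c γ) = F (γ 1) - F (γ 0)) → W = ⊤ := by
  let R : ModuleCat.{u} ℝ := ModuleCat.of ℝ (ULift.{u} ℝ)
  let S := TopCat.toSSet.obj (TopCat.of M)
  let K := S.chainComplex R
  change ∃ c : C(I, M) → K.homology 1, IsPathCocycle c ∧ ∀ W : Submodule ℝ (K.homology 1),
    (∃ F : M → K.homology 1 ⧸ W, ∀ γ : C(I, M), W.mkQ (c γ) = F (γ 1) - F (γ 0)) → W = ⊤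
  -- Over a field, the inclusion of homology into chains modulo boundaries has a retraction.
  obtain ⟨r, hr⟩ := (K.homologyι 1).hom.exists_leftInverse_of_injective
    (LinearMap.ker_eq_bot.2 ((ModuleCat.mono_iff_injective _).1 inferInstance))
  let one : R := ULift.up 1
  refine ⟨fun γ => r ((S.ιChainComplex (pathSimplex γ) ≫ K.pOpcycles 1).hom one), ?_, ?_⟩
  · intro Q
    obtain ⟨h0, h1, h2⟩ := δ_squareTriangle Q
    have h := S.ιChainComplex_d_assoc (R := R) (((TopCat.of M).toSSetObjEquiv (.op ⦋2⦌)).symm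
      (Q.comp squareTriangle)) (K.pOpcycles 1)
    rw [K.d_pOpcycles, Limits.comp_zero, Fin.sum_univ_three] at h
    erw [h0, h1, h2] at h
    have h' := congrArg (fun φ => r (φ.hom one)) h
    simp [Preadditive.add_comp] at h' ⊢
    rw [← sub_eq_zero, h']
    abel
  · rintro W ⟨F, hF⟩
    -- `G` extends `F` linearly to the 0-chains.
    let G : K.X 0 ⟶ ModuleCat.of ℝ (K.homology 1 ⧸ W) :=
      Limits.Sigma.desc fun x => ModuleCat.ofHom
        ((LinearMap.toSpanSingleton ℝ _ (F (TopCat.toSSetObj₀Equiv x))).comp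
          (ULift.moduleEquiv (R := ℝ) (M := ℝ)).toLinearMap)
    have hG (x) : S.ιChainComplex x ≫ G = ModuleCat.ofHom
        ((LinearMap.toSpanSingleton ℝ _ (F (TopCat.toSSetObj₀Equiv x))).comp
          (ULift.moduleEquiv (R := ℝ) (M := ℝ)).toLinearMap) :=
      Limits.Sigma.ι_desc _ _
    have key : K.pOpcycles 1 ≫ ModuleCat.ofHom (W.mkQ.comp r) = K.d 1 0 ≫ G := by
      refine SSet.chainComplex_hom_ext fun s => ?_
      obtain ⟨γ, rfl⟩ := exists_pathSimplex_eq s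
      rw [S.ιChainComplex_d_assoc, Fin.sum_univ_two]
      erw [δ_zero_pathSimplex, δ_one_pathSimplex]
      ext x
      have h := hF γ
      have hx : x = x.down • one := ULift.ext _ _ (mul_one x.down).symm
      simp only [ModuleCat.hom_comp, LinearMap.comp_apply] at h
      simp [Preadditive.add_comp, hG] at h ⊢
      rw [← sub_eq_add_neg, ← smul_sub, ← h]
      conv_lhs => rw [hx, map_smul, map_smul]
      rfl
    -- On a cycle, the left side of `key` is its class modulo `W` and the right side vanishes.
    refine Submodule.eq_top_iff'.2 fun h => ?_
    obtain ⟨z, rfl⟩ := (ModuleCat.epi_iff_surjective (K.homologyπ 1)).1 inferInstance h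
    rw [← Submodule.Quotient.mk_eq_zero]
    have h1 := congrArg (fun φ => φ.hom z) (K.homology_π_ι 1)
    have h2 := LinearMap.congr_fun hr ((K.homologyπ 1).hom z)
    have h3 := congrArg (fun φ => (K.iCycles 1 ≫ φ).hom z) key
    rw [ModuleCat.hom_comp, LinearMap.comp_apply, ModuleCat.hom_comp, LinearMap.comp_apply] at h1
    rw [LinearMap.comp_apply, h1, LinearMap.id_apply] at h2
    rw [K.iCycles_d_assoc, Limits.zero_comp] at h3
    change Submodule.Quotient.mk ((K.homologyπ 1).hom z) = 0
    rw [← h2]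
    exact h3

end Homology

/-! ### Descent of primitives to a mapping torus -/

section Descent

variable {M V : Type*} [TopologicalSpace M] [AddCommGroup V] {c : C(I, M) → V}

/-- If two families of points of `X` parametrized by a connected space have the same images in `M`,
a local primitive takes equal values on all pairs as soon as it does on one. -/
theorem IsLocalPrimitive.apply_eq_apply {X Y : Type*} [TopologicalSpace X] [TopologicalSpace Y]
    [PreconnectedSpace Y] (hl : IsLocallyExact c) {q : X → M} {f : X → V}
    (hf : IsLocalPrimitive c q f) {u u' : Y → X} (hu : Continuous u) (hu' : Continuous u')
    (hq : ∀ y, q (u' y) = q (u y)) (y₀ : Y) (h₀ : f (u y₀) = f (u' y₀)) (y : Y) :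
    f (u y) = f (u' y) := by
  have h' : IsLocalPrimitive c (q ∘ u) (f ∘ u') := by
    rw [← show q ∘ u' = q ∘ u from funext hq]
    exact hf.comp hu'
  have h := (hf.comp hu).sub_eq_sub hl h' y y₀
  simp only [Function.comp_apply, h₀, sub_self] at h
  exact sub_eq_zero.1 h

theorem continuous_discBoundary : Continuous discBoundary := by
  unfold discBoundary
  fun_prop

/-- The projection of `disc × [0, 1]` onto `S_g × [0, 1]`. -/
def discCylinderMap (g : ℕ) : C(ClosedDisc × I, ClosedSurface g × I) where
  toFun := Prod.map (Quot.mk _) id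
  continuous_toFun := continuous_quot_mk.prodMap continuous_id

/-- The projection of `S × [0, 1]` onto the mapping torus of `φ : S ≃ₜ S`. -/
def cylinderMap {S : Type*} [TopologicalSpace S] (φ : S ≃ₜ S) : C(S × I, MappingTorus φ) where
  toFun := Quot.mk _
  continuous_toFun := continuous_quot_mk

theorem isQuotientMap_discCylinderMap (g : ℕ) : IsQuotientMap (discCylinderMap g) :=
  IsQuotientMap.prodMap_id (π := (Quot.mk (SurfaceRel g))) isQuotientMap_quot_mk

theorem isQuotientMap_cylinderMap {S : Type*} [TopologicalSpace S] (φ : S ≃ₜ S) :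
    IsQuotientMap (cylinderMap φ) := isQuotientMap_quot_mk

instance (g : ℕ) : ConnectedSpace (ClosedSurface g) := by
  have : ConnectedSpace ClosedDisc :=
    isConnected_iff_connectedSpace.1 ((convex_closedBall (0 : ℂ) 1).isConnected
      ⟨0, Metric.mem_closedBall_self zero_le_one⟩)
  exact Quot.mk_surjective.connectedSpace (continuous_quot_mk (r := SurfaceRel g))

instance {g : ℕ} (φ : ClosedSurface g ≃ₜ ClosedSurface g) : CompactSpace (MappingTorus φ) := by
  have : CompactSpace (ClosedSurface g) := inferInstanceAs (CompactSpace (Quot (SurfaceRel g)))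
  exact inferInstanceAs (CompactSpace (Quot (MappingTorusRel φ)))

theorem IsPathCocycle.exists_isPrimitiveAlong_of_convex_prod (hc : IsPathCocycle c)
    {E E' : Type*} [NormedAddCommGroup E] [NormedSpace ℝ E] [NormedAddCommGroup E']
    [NormedSpace ℝ E'] {C : Set E} {C' : Set E'} (hC : Convex ℝ C) (hC' : Convex ℝ C')
    (hne : C.Nonempty) (hne' : C'.Nonempty) (q : C(C × C', M)) :
    ∃ f, IsPrimitiveAlong c q f := by
  let e := Homeomorph.Set.prod C C'
  let e₁ : C(↥(C ×ˢ C'), C × C') := ⟨e, e.continuous⟩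
  let e₂ : C(C × C', ↥(C ×ˢ C')) := ⟨e.symm, e.symm.continuous⟩
  obtain ⟨f, hf⟩ := hc.exists_isPrimitiveAlong_of_convex (hC.prod hC') (hne.prod hne') (q.comp e₁)
  refine ⟨f ∘ e.symm, fun γ => ?_⟩
  have h : (q.comp e₁).comp (e₂.comp γ) = q.comp γ :=
    ContinuousMap.ext fun t => congrArg q (e.apply_symm_apply (γ t))
  rw [← h]
  exact hf (e₂.comp γ)

/-- A primitive on `disc × [0, 1]` descends to the mapping torus if it takes equal values at one
pair of identified points for each pair of sides, here the points where `s = 0` in the side pairing, and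
at one pair of points identified by the gluing. For `g = 0` there is no condition on the sides. -/
theorem IsPrimitiveAlong.exists_descent (hc : IsPathCocycle c) (hl : IsLocallyExact c) {g : ℕ}
    {φ : ClosedSurface g ≃ₜ ClosedSurface g} {q : C(MappingTorus φ, M)} {f : ClosedDisc × I → V}
    (hf : IsPrimitiveAlong c ((q.comp (cylinderMap φ)).comp (discCylinderMap g)) f)
    (hA : ∀ i < g, f (discBoundary ((4 * i) / (4 * g)), 0) =
      f (discBoundary ((4 * i + 3) / (4 * g)), 0))
    (hB : ∀ i < g, f (discBoundary ((4 * i + 1) / (4 * g)), 0) =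
      f (discBoundary ((4 * i + 4) / (4 * g)), 0))
    {d d' : ClosedDisc} (hd : (Quot.mk _ d' : ClosedSurface g) = φ (Quot.mk _ d))
    (hφ : f (d, 0) = f (d', 1)) :
    ∃ F : MappingTorus φ → V, IsPrimitiveAlong c q F := by
  have : LocallyPathConnectedSpace ClosedDisc :=
    (convex_closedBall (0 : ℂ) 1).locallyPathConnectedSpace
  have : LocallyPathConnectedSpace I := (convex_Icc (0 : ℝ) 1).locallyPathConnectedSpace
  have hf' := hf.isLocalPrimitive
  have hdB := continuous_discBoundary
  have hrel : ∀ x y, SurfaceRel g x y → ∀ t, f (x, t) = f (y, t) := by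
    intro x y hxy t
    have hq {x y} (h : SurfaceRel g x y) (t : I) :
        ((q.comp (cylinderMap φ)).comp (discCylinderMap g)) (y, t) =
        ((q.comp (cylinderMap φ)).comp (discCylinderMap g)) (x, t) :=
      congrArg (fun z : ClosedSurface g => q (cylinderMap φ (z, t))) (Quot.sound h).symm
    cases hxy with
    | sideA i hi s hs =>
      refine hf'.apply_eq_apply hl (Y := I × I)
        (u := fun y => (discBoundary ((4 * i + y.1) / (4 * g)), y.2))
        (u' := fun y => (discBoundary ((4 * i + 3 - y.1) / (4 * g)), y.2)) (by fun_prop)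
        (by fun_prop) (fun y => hq (.sideA i hi _ y.1.2) _) (0, 0) ?_ (⟨s, hs⟩, t)
      simpa using hA i hi
    | sideB i hi s hs =>
      refine hf'.apply_eq_apply hl (Y := I × I)
        (u := fun y => (discBoundary ((4 * i + 1 + y.1) / (4 * g)), y.2))
        (u' := fun y => (discBoundary ((4 * i + 4 - y.1) / (4 * g)), y.2)) (by fun_prop)
        (by fun_prop) (fun y => hq (.sideB i hi _ y.1.2) _) (0, 0) ?_ (⟨s, hs⟩, t)
      simpa using hB i hi
    | sphere hg s s' =>
      -- The whole boundary circle has one image, so the diagonal provides the base point.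
      exact hf'.apply_eq_apply hl (Y := (ℝ × ℝ) × I)
        (u := fun y => (discBoundary y.1.1, y.2))
        (u' := fun y => (discBoundary y.1.2, y.2)) (by fun_prop)
        (by fun_prop) (fun y => hq (.sphere hg _ _) _) ((0, 0), 0) rfl ((s, s'), t)
  let F₁ : ClosedSurface g × I → V := fun p =>
    Quot.lift (fun x => f (x, p.2)) (fun x y h => hrel x y h p.2) p.1
  have hF₁ : IsLocalPrimitive c (q.comp (cylinderMap φ)) F₁ :=
    .of_comp_isQuotientMap (isQuotientMap_discCylinderMap g) (ContinuousMap.continuous _) hf'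
  have hglue (x : ClosedSurface g) : F₁ (x, 0) = F₁ (φ x, 1) := by
    refine hF₁.apply_eq_apply hl (Y := ClosedSurface g)
      (u := fun x => (x, 0)) (u' := fun x => (φ x, 1)) (by fun_prop) (by fun_prop)
      (fun x => congrArg q (Quot.sound (.glue x)).symm) (Quot.mk _ d) ?_ x
    rw [← hd]
    exact hφ
  let F : MappingTorus φ → V := Quot.lift F₁ (by rintro _ _ ⟨x⟩; exact hglue x)
  refine ⟨F, IsLocalPrimitive.isPrimitiveAlong hc hl ?_⟩
  exact .of_comp_isQuotientMap (isQuotientMap_cylinderMap φ) (ContinuousMap.continuous _) hF₁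

end Descent

/-! ### The Betti number bound -/

/-- `H₁(M; ℝ)` is spanned by the `2 g + 1` differences of values, at identified points, of a
primitive on `disc × [0, 1]`: two for every handle of the fiber, and one for the monodromy. -/
theorem bettiNumber_one_le_of_hasFiberedCovering {M : Type u} [TopologicalSpace M]
    (hM : IsClosedHyperbolicManifold3 M) {g : ℕ} (hg : HasFiberedCovering M g) :
    bettiNumber 1 M ≤ 2 * g + 1 := by
  obtain ⟨φ, p, hp⟩ := hg
  have := hM.t2
  have := hM.connected
  obtain ⟨c, hc, huniv⟩ := exists_universal_pathCocycle M
  have hl := hc.isLocallyExact_of_charts hM.hyperbolic.exists_euclidean_chart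
  let q : C(MappingTorus φ, M) := ⟨p, hp.continuous⟩
  obtain ⟨f, hf⟩ := hc.exists_isPrimitiveAlong_of_convex_prod
    (convex_closedBall (0 : ℂ) 1) (convex_Icc (0 : ℝ) 1)
    ⟨0, Metric.mem_closedBall_self zero_le_one⟩ (nonempty_Icc.2 zero_le_one)
    ((q.comp (cylinderMap φ)).comp (discCylinderMap g))
  let d : ClosedDisc := ⟨0, Metric.mem_closedBall_self zero_le_one⟩
  obtain ⟨d', hd'⟩ := Quot.exists_rep (φ (Quot.mk _ d))
  -- The gluing is tested at the center of the disc, the sides at the base points of the pairing.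
  let v : (Fin g ⊕ Fin g) ⊕ Unit → realSingularHomology 1 M := Sum.elim (Sum.elim
    (fun i => f (discBoundary ((4 * (i : ℕ)) / (4 * g)), 0) -
      f (discBoundary ((4 * (i : ℕ) + 3) / (4 * g)), 0))
    (fun i => f (discBoundary ((4 * (i : ℕ) + 1) / (4 * g)), 0) -
      f (discBoundary ((4 * (i : ℕ) + 4) / (4 * g)), 0)))
    (fun _ => f (d, 0) - f (d', 1))
  let W := Submodule.span ℝ (range v)
  have hv (j) : v j ∈ W := Submodule.subset_span (mem_range_self j)
  let L : realSingularHomology 1 M →+ realSingularHomology 1 M ⧸ W := W.mkQ.toAddMonoidHom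
  have hL {x y : realSingularHomology 1 M} (h : x - y ∈ W) : L x = L y :=
    (Submodule.Quotient.eq W).2 h
  have hcL := hc.map L
  have hlL := hl.map L
  obtain ⟨F, hF⟩ := (hf.map L).exists_descent hcL hlL
    (fun i hi => hL (hv (.inl (.inl ⟨i, hi⟩)))) (fun i hi => hL (hv (.inl (.inr ⟨i, hi⟩))))
    hd' (hL (hv (.inr ())))
  have : Nonempty (MappingTorus φ) := ⟨cylinderMap φ (Quot.mk _ d, 0)⟩
  have hW : W = ⊤ := huniv W (hp.exists_primitive hp.surjective hp.finite_fiber hF)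
  calc bettiNumber 1 M = Module.finrank ℝ W := by rw [hW, finrank_top]; rfl
    _ ≤ Fintype.card ((Fin g ⊕ Fin g) ⊕ Unit) := finrank_range_le_card v
    _ = 2 * g + 1 := by simp [two_mul]

theorem mainTheorem6 (M : Type u) [TopologicalSpace M] (hM : IsClosedHyperbolicManifold3 M) :
    ((((bettiNumber 1 M : ℝ) - 1) / 2 : ℝ) : EReal) ≤ ((fiberGenus M : ℝ≥0∞) : EReal) := by
  -- `⌊b / 2⌋` is the least natural number `n` with `(b - 1) / 2 ≤ n`.
  have key : ((bettiNumber 1 M / 2 : ℕ) : ℕ∞) ≤ fiberGenus M := by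
    refine le_iInf₂ fun g hg => ?_
    have := bettiNumber_one_le_of_hasFiberedCovering hM hg
    exact_mod_cast (by omega : bettiNumber 1 M / 2 ≤ g)
  calc ((((bettiNumber 1 M : ℝ) - 1) / 2 : ℝ) : EReal)
      ≤ (((bettiNumber 1 M / 2 : ℕ) : ℝ) : EReal) := by
        have h : (bettiNumber 1 M : ℝ) ≤ 2 * ((bettiNumber 1 M / 2 : ℕ) : ℝ) + 1 := by
          exact_mod_cast (by omega : bettiNumber 1 M ≤ 2 * (bettiNumber 1 M / 2) + 1)
        exact EReal.coe_le_coe_iff.2 (by linarith)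
    _ = ((((bettiNumber 1 M / 2 : ℕ) : ℕ∞) : ℝ≥0∞) : EReal) := by
        rw [ENat.toENNReal_coe, ← ENNReal.ofReal_natCast, EReal.coe_ennreal_ofReal,
          max_eq_left (Nat.cast_nonneg _)]
    _ ≤ ((fiberGenus M : ℝ≥0∞) : EReal) := by
        exact EReal.coe_ennreal_le_coe_ennreal_iff.2 (ENat.toENNReal_le.2 key)
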